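/- Let $S=(N,M_0)$ be a net system: $N$ is a net with finite sets $P$ of places and $T$ of transitions and flow relation $F\subseteq (P\times T)\cup(T\times P)$, and $M_0:P\to\mathbb N$ is a marking. Assume that every transition $t$ of $N$ with ${}^\bullet t=\emptyset$ also has $t^\bullet=\emptyset$. (This holds if $S$ is bounded, and also if every transition has an input place.) Transitions fire as usual: $t$ is enabled at $M$ if $M(p)\ge 1$ for all $p\in{}^\bullet t$, and then $M\xrightarrow{t}M'=M-{}^\bullet t+t^\bullet$. Write $t_1<_{tar}t_2$ if there are a reachable marking $M_s$ of $S$ and a marking $M_s'$ such that $M_s\xrightarrow{t_1}M_s'$ and $t_2$ is enabled at $M_s'$. In a net, $x<y$ means that there is a path with at least one arc from $x$ to $y$, and $x\# y$ means that there are paths to $x$ and to $y$ that start at the same place and continue with two different transitions. An occurrence net $O=(C,E,G)$, with conditions $C$ as places and events $E$ as transitions, is an acyclic net in which every condition has at most one input event, no node $x$ satisfies $x\# x$, and every node has finitely many predecessors; $\mathrm{Min}(O)$ is the set of conditions without input event. A branching process $(O,h)$ of $S$ is an occurrence net with a map $h$, $h(C)\subseteq P$, $h(E)\subseteq T$, which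 restricts to bijections ${}^\bullet e\to{}^\bullet h(e)$ and $e^\bullet\to h(e)^\bullet$ for every event $e$, such that $\mathrm{Min}(O)$ is finite, contains exactly $M_0(p)$ conditions labelled $p$ for every place $p$, and two events with the same label and the same preset are equal. For a marking $M$ of $O$, $h(M)$ is the marking $p\mapsto\sum_{h(c)=p}M(c)$ of $N$. An unfolding of $S$ is a maximal branching process, i.e. one that is not isomorphic to a proper prefix of another branching process. Let $(O,h)$ be an unfolding of $S$. A configuration is a set $K$ of events that is conflict-free and contains every event $f<e$ for $e\in K$; $[e]=\{x\in E: x<e\vee x=e\}$; for finite $K$, $\mathrm{Cut}(K)=(\mathrm{Min}(O)\cup K^\bullet)\setminus{}^\bullet K$ and $\mathrm{Mark}(K)=h(\mathrm{Cut}(K))$. Let $\prec$ be an adequate order, i.e. a strict well-founded partial order on the finite configurations such that $K\subset L$ implies $K\prec L$ and which is preserved by finite extensions: if $K_1\prec K_2$, $\mathrm{Mark}(K_1)=\mathrm{Mark}(K_2)$ and $K_2\oplus F_2$ is a finite extension of $K_2$ whose suffix $F_2$ has an isomorphic copy that extends $K_1$, then $K_1\oplus F_1\prec K_2\oplus F_2$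 for at least one such copy $F_1$. An event $e$ is a cut-off event if there is an event $e'$ with $\mathrm{Mark}([e])=\mathrm{Mark}([e'])$ and $[e']\prec[e]$. The complete prefix unfolding $\pi$ is the greatest backward closed subnet of the unfolding that contains no event after any cut-off event, with the labelling $h$ and the initial marking that puts one token on every minimal condition. For events $e_1,e_2$ of $\pi$, write $e_1<_{ear}e_2$ if there are reachable markings $M_1,M_1',M_2,M_2'$ of $\pi$ such that $M_1\xrightarrow{e_1}M_1'$, $M_2\xrightarrow{e_2}M_2'$ and $h(M_2)=h(M_1')$. Then, for all transitions $t_1,t_2$ of $S$: $t_1<_{tar}t_2$ if and only if there are events $e_1,e_2$ of $\pi$ with $h(e_1)=t_1$, $h(e_2)=t_2$ and $e_1<_{ear}e_2$. -/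

import Mathlib

/-- A net with places `P`, transitions `T` and flow relation `arcPT ∪ arcTP`. -/
structure PetriNet (P T : Type*) where
  /-- arcs from places to transitions -/
  arcPT : P → T → Prop
  /-- arcs from transitions to places -/
  arcTP : T → P → Prop

namespace PetriNet

variable {P T : Type*} (N : PetriNet P T)

/-- The preset of a transition. -/
def pre (t : T) : Set P := {p | N.arcPT p t}

/-- The postset of a transition. -/
def post (t : T) : Set P := {p | N.arcTP t p}

/-- `t` is enabled at the marking `M`. -/
def Enabled (M : P → ℕ) (t : T) : Prop := ∀ p ∈ N.pre t, 1 ≤ M p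

/-- `M'` is reached from `M` by firing `t`, that is, `M' = M - pre t + post t`. -/
def Fires (M : P → ℕ) (t : T) (M' : P → ℕ) : Prop :=
  N.Enabled M t ∧
    ∀ p, M' p + (N.pre t).indicator 1 p = M p + (N.post t).indicator 1 p

/-- `M'` is reachable from `M` by a (possibly empty) firing sequence. -/
def Reachable (M M' : P → ℕ) : Prop :=
  Relation.ReflTransGen (fun M₁ M₂ => ∃ t, N.Fires M₁ t M₂) M M'

/-- The flow relation, on the nodes of the net. -/
def Arc : P ⊕ T → P ⊕ T → Prop
  | Sum.inl p, Sum.inr t => N.arcPT p t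
  | Sum.inr t, Sum.inl p => N.arcTP t p
  | _, _ => False

/-- The causal relation `x < y`: there is a path with at least one arc from `x` to `y`. -/
def Causal (x y : P ⊕ T) : Prop := Relation.TransGen N.Arc x y

/-- The conflict relation `x # y`: there are paths to `x` and to `y` that start at the same
place and immediately diverge. -/
def Conflict (x y : P ⊕ T) : Prop :=
  ∃ (s : P) (t₁ t₂ : T), t₁ ≠ t₂ ∧ s ∈ N.pre t₁ ∧ s ∈ N.pre t₂ ∧
    Relation.ReflTransGen N.Arc (Sum.inr t₁) x ∧ Relation.ReflTransGen N.Arc (Sum.inr t₂) y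

/-- Occurrence nets (places are called conditions and transitions are called events). -/
structure IsOccurrenceNet : Prop where
  acyclic : ∀ x, ¬ N.Causal x x
  pre_condition : ∀ (c : P) (e e' : T), N.arcTP e c → N.arcTP e' c → e = e'
  no_self_conflict : ∀ x, ¬ N.Conflict x x
  finite_past : ∀ x, {y | N.Causal y x}.Finite

/-- The minimal conditions: those without a predecessor. -/
def minConditions : Set P := {c | ∀ e, ¬ N.arcTP e c}

/-- The initial marking of an occurrence net: one token on every minimal condition. -/
noncomputable def minMarking : P → ℕ := N.minConditions.indicator 1

/-- Configurations: conflict-free, causally closed sets of events. -/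
def IsConfiguration (K : Set T) : Prop :=
  (∀ e ∈ K, ∀ f ∈ K, ¬ N.Conflict (Sum.inr e) (Sum.inr f)) ∧
    ∀ e ∈ K, ∀ f, N.Causal (Sum.inr f) (Sum.inr e) → f ∈ K

/-- Finite configurations. -/
def IsFinConfiguration (K : Set T) : Prop := N.IsConfiguration K ∧ K.Finite

/-- The local configuration `[e]` of an event. -/
def localConf (e : T) : Set T := {x | N.Causal (Sum.inr x) (Sum.inr e) ∨ x = e}

/-- The postset of a set of events. -/
def postSet (K : Set T) : Set P := ⋃ e ∈ K, N.post e

/-- The preset of a set of events. -/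
def preSet (K : Set T) : Set P := ⋃ e ∈ K, N.pre e

/-- The set of conditions marked after the events of `K` have been fired. -/
def cut (K : Set T) : Set P := (N.minConditions ∪ N.postSet K) \ N.preSet K

/-- `F` is a suffix of the configuration `K`: `K` and `F` are disjoint and `K ∪ F` is a finite
configuration (an extension of `K`). -/
def IsSuffix (K F : Set T) : Prop := Disjoint K F ∧ N.IsFinConfiguration (K ∪ F)

end PetriNet

/-- A net system: a net with an initial marking. -/
structure NetSystem (P T : Type*) where
  net : PetriNet P T
  M₀ : P → ℕ

/-- The transition adjacency relation of a net system. -/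
def NetSystem.TAR {P T : Type*} (S : NetSystem P T) (t₁ t₂ : T) : Prop :=
  ∃ M M' : P → ℕ, S.net.Reachable S.M₀ M ∧ S.net.Fires M t₁ M' ∧ S.net.Enabled M' t₂

/-- A net with conditions `C` and events `E`, whose conditions are labelled by places in `P` and
whose events are labelled by transitions in `T`. -/
structure LabelledNet (P T C E : Type*) where
  net : PetriNet C E
  hC : C → P
  hE : E → T

namespace LabelledNet

variable {P T C E : Type*} (β : LabelledNet P T C E)

/-- The image `h(M)` of a marking of conditions: `h(M)(p)` is the number of tokens of `M` on
conditions labelled by `p`. -/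
noncomputable def mapMarking (M : C → ℕ) : P → ℕ :=
  fun p => ∑ᶠ (c : C) (_ : β.hC c = p), M c

/-- The marking `Mark(K)` of the original system that is represented by a configuration `K`. -/
noncomputable def mark (K : Set E) : P → ℕ := β.mapMarking ((β.net.cut K).indicator 1)

/-- `β` is a branching process of `S`: an occurrence net whose labelling is a homomorphism to `S`
that identifies no two events with the same label and the same preset. -/
structure IsBranching (S : NetSystem P T) : Prop where
  occ : β.net.IsOccurrenceNet
  pre_bij : ∀ e, Set.BijOn β.hC (β.net.pre e) (S.net.pre (β.hE e))
  post_bij : ∀ e, Set.BijOn β.hC (β.net.post e) (S.net.post (β.hE e))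
  min_finite : β.net.minConditions.Finite
  min_eq : β.mapMarking β.net.minMarking = S.M₀
  event_ext : ∀ e e', β.hE e = β.hE e' → β.net.pre e = β.net.pre e' → e = e'

/-- `(f, g)` identifies `β` with a prefix of `β'`: it is injective, respects labels, presets and
postsets of events, and its image is closed under predecessors. -/
structure IsPrefixEmbedding {C' E' : Type*} (β' : LabelledNet P T C' E')
    (f : C → C') (g : E → E') : Prop where
  inj_condition : Function.Injective f
  inj_event : Function.Injective g
  label_condition : ∀ c, β'.hC (f c) = β.hC c
  label_event : ∀ e, β'.hE (g e) = β.hE e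
  pre_eq : ∀ e, β'.net.pre (g e) = f '' β.net.pre e
  post_eq : ∀ e, β'.net.post (g e) = f '' β.net.post e
  closed : ∀ c e', β'.net.arcTP e' (f c) → e' ∈ Set.range g

/-- The events of the suffix `F₁` of `K₁` and those of the suffix `F₂` of `K₂` are isomorphic, as
labelled nets that start from the cuts of `K₁` and of `K₂`. -/
def SuffixIso (K₁ F₁ K₂ F₂ : Set E) : Prop :=
  ∃ (γ : C → C) (φ : E → E),
    Set.BijOn φ F₁ F₂ ∧
    Set.BijOn γ (β.net.cut K₁ ∪ β.net.postSet F₁) (β.net.cut K₂ ∪ β.net.postSet F₂) ∧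
    (∀ c ∈ β.net.cut K₁ ∪ β.net.postSet F₁, β.hC (γ c) = β.hC c) ∧
    ∀ e ∈ F₁, β.hE (φ e) = β.hE e ∧ β.net.pre (φ e) = γ '' β.net.pre e ∧
      β.net.post (φ e) = γ '' β.net.post e

/-- Adequate orders: strict well-founded partial orders on the finite configurations that refine
set inclusion and are preserved by finite extensions. When a place can carry several tokens, a
suffix of `K₂` may have several isomorphic copies over `K₁` (over 1-safe nets there is at most
one); preservation is only required for some copy, if there is any. -/
structure IsAdequate (r : Set E → Set E → Prop) : Prop where
  irrefl : ∀ K, β.net.IsFinConfiguration K → ¬ r K K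
  trans : ∀ K L M, β.net.IsFinConfiguration K → β.net.IsFinConfiguration L →
    β.net.IsFinConfiguration M → r K L → r L M → r K M
  wf : Set.WellFoundedOn {K | β.net.IsFinConfiguration K} r
  refines : ∀ K L, β.net.IsFinConfiguration K → β.net.IsFinConfiguration L → K ⊂ L → r K L
  preserved : ∀ K₁ K₂, β.net.IsFinConfiguration K₁ → β.net.IsFinConfiguration K₂ →
    β.mark K₁ = β.mark K₂ → r K₁ K₂ → ∀ F₂, β.net.IsSuffix K₂ F₂ →
    (∃ F, β.net.IsSuffix K₁ F ∧ β.SuffixIso K₁ F K₂ F₂) →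
    ∃ F₁, β.net.IsSuffix K₁ F₁ ∧ β.SuffixIso K₁ F₁ K₂ F₂ ∧ r (K₁ ∪ F₁) (K₂ ∪ F₂)

/-- Cut-off events with respect to the order `r`. -/
def IsCutoff (r : Set E → Set E → Prop) (e : E) : Prop :=
  ∃ e', β.mark (β.net.localConf e) = β.mark (β.net.localConf e') ∧
    r (β.net.localConf e') (β.net.localConf e)

/-- A subnet, given by its conditions `D.1` and its events `D.2`, is backward closed. -/
def BackwardClosed (D : Set C × Set E) : Prop :=
  (∀ c ∈ D.1, ∀ e, β.net.arcTP e c → e ∈ D.2) ∧ ∀ e ∈ D.2, ∀ c, β.net.arcPT c e → c ∈ D.1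

/-- `D` is the greatest backward closed subnet that contains no event after a cut-off event. -/
def IsCutoffPrefix (r : Set E → Set E → Prop) (D : Set C × Set E) : Prop :=
  IsGreatest {D : Set C × Set E | β.BackwardClosed D ∧
    ∀ e ∈ D.2, ∀ f, β.IsCutoff r f → ¬ β.net.Causal (Sum.inr f) (Sum.inr e)} D

/-- The labelled subnet induced by the conditions `D.1` and the events `D.2`. -/
def restrict (D : Set C × Set E) : LabelledNet P T D.1 D.2 where
  net := { arcPT := fun c e => β.net.arcPT c e, arcTP := fun e c => β.net.arcTP e c }
  hC := fun c => β.hC c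
  hE := fun e => β.hE e

/-- A marking of `β` that is reachable from its initial marking. -/
def ReachableMarking (M : C → ℕ) : Prop := β.net.Reachable β.net.minMarking M

/-- The event adjacency relation of a labelled occurrence net. -/
def EAR (e₁ e₂ : E) : Prop :=
  ∃ M₁ M₁' M₂ M₂' : C → ℕ,
    β.ReachableMarking M₁ ∧ β.ReachableMarking M₁' ∧
    β.ReachableMarking M₂ ∧ β.ReachableMarking M₂' ∧
    β.net.Fires M₁ e₁ M₁' ∧ β.net.Fires M₂ e₂ M₂' ∧ β.mapMarking M₂ = β.mapMarking M₁'

end LabelledNet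

/-- `β` is an unfolding of `S`, that is, a maximal branching process: whenever `β` is identified
with a prefix of a branching process `β'` of `S`, this prefix is all of `β'`. -/
def LabelledNet.IsUnfolding.{uP, uT, uC, uE} {P : Type uP} {T : Type uT} {C : Type uC}
    {E : Type uE} (β : LabelledNet P T C E) (S : NetSystem P T) : Prop :=
  β.IsBranching S ∧
    ∀ (C' : Type uC) (E' : Type uE) (β' : LabelledNet P T C' E') (f : C → C') (g : E → E'),
      β'.IsBranching S → β.IsPrefixEmbedding β' f g →
        Function.Surjective f ∧ Function.Surjective g

/-! The relation `EAR` only asks that the second event fires at some reachable marking with the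
right image in `S`. Two facts therefore suffice. Firing in the prefix projects to firing in `S`
(`mapMarking_fires`, `mapMarking_reachable`), which gives the backward direction. Conversely, every
reachable marking of `S` and every transition enabled there are represented in the prefix
(`IsCutoffPrefix.exists_reachable_fires`); this is applied to the markings before and after `t₁`.

The second fact rests on completeness. Among the finite configurations representing a marking, take
an `r`-minimal one, `K`. If `K` contained a cut-off `e` with companion `e'`, a copy of `K \ [e]`
could be appended to `[e']`, giving a smaller configuration with the same marking. The copy exists
by `exists_suffixIso`, which uses maximality of the unfolding: a missing event could be added to it
(`addEvent`).

An event with empty preset occurs at most once per label, so it cannot be copied. By `hS` it has no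
effect on markings, and minimality of `K` excludes it. -/

namespace PetriNet

open Relation Set

variable {P T : Type*} {N : PetriNet P T}

/-! ### Causality, configurations and cuts in occurrence nets. -/

theorem exists_post_of_reflTransGen {f : T} {c : P}
    (h : ReflTransGen N.Arc (Sum.inr f) (Sum.inl c)) :
    ∃ g, c ∈ N.post g ∧ ReflTransGen N.Arc (Sum.inr f) (Sum.inr g) := by
  rcases h.cases_tail with h | ⟨p | g, hx, hxc⟩
  · cases h
  · exact hxc.elim
  · exact ⟨g, hxc, hx⟩

theorem causal_inr_iff {x : P ⊕ T} {e : T} :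
    N.Causal x (Sum.inr e) ↔ ∃ c ∈ N.pre e, ReflTransGen N.Arc x (Sum.inl c) := by
  constructor
  · intro h
    obtain ⟨c | g, hxc, hce⟩ := TransGen.tail'_iff.1 h
    · exact ⟨c, hce, hxc⟩
    · exact hce.elim
  · rintro ⟨c, hc, h⟩
    exact TransGen.tail' (b := Sum.inl c) h hc

theorem causal_of_mem_post_of_mem_pre {c : P} {e f : T} (he : c ∈ N.post e) (hf : c ∈ N.pre f) :
    N.Causal (Sum.inr e) (Sum.inr f) :=
  causal_inr_iff.2 ⟨c, hf, ReflTransGen.single he⟩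

theorem reflTransGen_inr_iff {f e : T} :
    ReflTransGen N.Arc (Sum.inr f) (Sum.inr e) ↔ f = e ∨ N.Causal (Sum.inr f) (Sum.inr e) := by
  rw [reflTransGen_iff_eq_or_transGen, Sum.inr.injEq, eq_comm]
  rfl

namespace IsConfiguration

variable {K : Set T}

theorem mem_of_le (hK : N.IsConfiguration K) {e f : T} (he : e ∈ K)
    (h : ReflTransGen N.Arc (Sum.inr f) (Sum.inr e)) : f ∈ K := by
  rcases reflTransGen_inr_iff.1 h with rfl | h
  · exact he
  · exact hK.2 e he f h

theorem eq_of_mem_pre (hK : N.IsConfiguration K) {c : P} {e f : T} (he : e ∈ K) (hf : f ∈ K)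
    (hce : c ∈ N.pre e) (hcf : c ∈ N.pre f) : e = f := by
  by_contra hne
  exact hK.1 e he f hf ⟨c, e, f, hne, hce, hcf, .refl, .refl⟩

theorem subset_of_closed (hK : N.IsConfiguration K) {L : Set T} (hL : L ⊆ K)
    (hc : ∀ e ∈ L, ∀ f, N.Causal (Sum.inr f) (Sum.inr e) → f ∈ L) : N.IsConfiguration L :=
  ⟨fun e he f hf => hK.1 e (hL he) f (hL hf), hc⟩

end IsConfiguration

theorem isConfiguration_empty : N.IsConfiguration ∅ :=
  ⟨fun _ h => h.elim, fun _ h => h.elim⟩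

@[simp]
theorem postSet_empty : N.postSet ∅ = ∅ := by simp [postSet]

@[simp]
theorem preSet_empty : N.preSet ∅ = ∅ := by simp [preSet]

@[simp]
theorem cut_empty : N.cut ∅ = N.minConditions := by simp [cut]

theorem mem_postSet {K : Set T} {c : P} : c ∈ N.postSet K ↔ ∃ e ∈ K, c ∈ N.post e := by
  simp [postSet]

theorem mem_preSet {K : Set T} {c : P} : c ∈ N.preSet K ↔ ∃ e ∈ K, c ∈ N.pre e := by
  simp [preSet]

theorem mem_cut {K : Set T} {c : P} : c ∈ N.cut K ↔
    (c ∈ N.minConditions ∨ ∃ e ∈ K, c ∈ N.post e) ∧ ∀ e ∈ K, c ∉ N.pre e := by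
  simp [cut, postSet, preSet]

theorem postSet_insert (e : T) (K : Set T) : N.postSet (insert e K) = N.post e ∪ N.postSet K := by
  simp [postSet]

theorem not_mem_minConditions {c : P} {e : T} (h : c ∈ N.post e) : c ∉ N.minConditions :=
  fun hc => hc e h

namespace IsOccurrenceNet

variable {K : Set T} {e : T}

theorem isFinConfiguration_localConf (hN : N.IsOccurrenceNet) (e : T) :
    N.IsFinConfiguration (N.localConf e) := by
  have le : ∀ f ∈ N.localConf e, ReflTransGen N.Arc (Sum.inr f) (Sum.inr e) := fun f hf =>
    reflTransGen_inr_iff.2 hf.symm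
  refine ⟨⟨?_, ?_⟩, ?_⟩
  · rintro f hf g hg ⟨s, t₁, t₂, hne, h₁, h₂, h₃, h₄⟩
    exact hN.no_self_conflict _ ⟨s, t₁, t₂, hne, h₁, h₂, h₃.trans (le f hf), h₄.trans (le g hg)⟩
  · exact fun f hf g hgf => .inl (TransGen.trans_left hgf (le f hf))
  · have : N.localConf e ⊆ Sum.inr ⁻¹' {y | N.Causal y (Sum.inr e)} ∪ {e} := fun x hx => hx
    exact (((hN.finite_past (Sum.inr e)).preimage Sum.inr_injective.injOn).union
      (finite_singleton e)).subset this

/-- Every event below a condition of the cut of `K` belongs to `K`. -/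
theorem mem_of_le_cut (hN : N.IsOccurrenceNet) (hK : N.IsConfiguration K) {c : P}
    (hc : c ∈ N.cut K) {f : T} (h : ReflTransGen N.Arc (Sum.inr f) (Sum.inl c)) : f ∈ K := by
  obtain ⟨g, hg, hfg⟩ := exists_post_of_reflTransGen h
  rcases (mem_cut.1 hc).1 with hc | ⟨g', hg', hcg'⟩
  · exact (hc g hg).elim
  · obtain rfl := hN.pre_condition c g g' hg hcg'
    exact hK.mem_of_le hg' hfg

/-- Everything strictly below `e` is below a condition of the cut, hence in `K`. A conflict between
`e` and `K` would give either a condition of the cut consumed in `K`, or two events of `K` sharing a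
precondition. -/
theorem isConfiguration_insert (hN : N.IsOccurrenceNet) (hK : N.IsConfiguration K)
    (he : N.pre e ⊆ N.cut K) : N.IsConfiguration (insert e K) := by
  have mem : ∀ f, N.Causal (Sum.inr f) (Sum.inr e) → f ∈ K := by
    intro f hf
    obtain ⟨c, hc, hfc⟩ := causal_inr_iff.1 hf
    exact hN.mem_of_le_cut hK (he hc) hfc
  have key : ∀ f ∈ K, ∀ (s : P) (t₁ t₂ : T), t₁ ≠ t₂ → s ∈ N.pre t₁ → s ∈ N.pre t₂ →
      ReflTransGen N.Arc (Sum.inr t₁) (Sum.inr e) →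
      ReflTransGen N.Arc (Sum.inr t₂) (Sum.inr f) → False := by
    intro f hf s t₁ t₂ hne h₁ h₂ h₃ h₄
    have ht₂ := hK.mem_of_le hf h₄
    rcases reflTransGen_inr_iff.1 h₃ with rfl | h₃
    · exact (mem_cut.1 (he h₁)).2 _ ht₂ h₂
    · exact hne (hK.eq_of_mem_pre (mem _ h₃) ht₂ h₁ h₂)
  refine ⟨?_, ?_⟩
  · rintro f (rfl | hf) g (rfl | hg) hfg
    · exact hN.no_self_conflict _ hfg
    · obtain ⟨s, t₁, t₂, hne, h₁, h₂, h₃, h₄⟩ := hfg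
      exact key g hg s t₁ t₂ hne h₁ h₂ h₃ h₄
    · obtain ⟨s, t₁, t₂, hne, h₁, h₂, h₃, h₄⟩ := hfg
      exact key f hf s t₂ t₁ hne.symm h₂ h₁ h₄ h₃
    · exact hK.1 f hf g hg hfg
  · rintro f (rfl | hf) g hg
    · exact .inr (mem g hg)
    · exact .inr (hK.2 f hf g hg)

theorem pre_subset_cut (hN : N.IsOccurrenceNet) (h : N.IsConfiguration (insert e K))
    (he : e ∉ K) : N.pre e ⊆ N.cut K := by
  intro c hc
  refine mem_cut.2 ⟨?_, ?_⟩
  · by_cases hm : c ∈ N.minConditions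
    · exact .inl hm
    · obtain ⟨g, hg⟩ : ∃ g, c ∈ N.post g := by simpa [minConditions, post] using hm
      have hge := causal_of_mem_post_of_mem_pre hg hc
      rcases h.2 e (mem_insert _ _) g hge with rfl | hgK
      · exact (hN.acyclic _ hge).elim
      · exact .inr ⟨g, hgK, hg⟩
  · intro f hf hcf
    exact he (h.eq_of_mem_pre (mem_insert _ _) (mem_insert_of_mem _ hf) hc hcf ▸ hf)

theorem not_mem_preSet_insert (hN : N.IsOccurrenceNet) (hK : N.IsConfiguration K) (he : e ∉ K)
    {c : P} (hc : c ∈ N.post e) : c ∉ N.preSet (insert e K) := by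
  rw [mem_preSet]
  rintro ⟨f, rfl | hf, hcf⟩
  · exact hN.acyclic _ (causal_of_mem_post_of_mem_pre hc hcf)
  · exact he (hK.2 f hf e (causal_of_mem_post_of_mem_pre hc hcf))

theorem not_mem_postSet (hN : N.IsOccurrenceNet) (he : e ∉ K) {c : P} (hc : c ∈ N.post e) :
    c ∉ N.postSet K := by
  rw [mem_postSet]
  rintro ⟨f, hf, hcf⟩
  exact he (hN.pre_condition c e f hc hcf ▸ hf)

theorem disjoint_post_cut (hN : N.IsOccurrenceNet) (he : e ∉ K) :
    Disjoint (N.post e) (N.cut K) :=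
  disjoint_left.2 fun _ hc h => h.1.elim (not_mem_minConditions hc) (hN.not_mem_postSet he hc)

theorem cut_insert (hN : N.IsOccurrenceNet) (hK : N.IsConfiguration K) (he : e ∉ K) :
    N.cut (insert e K) = N.cut K \ N.pre e ∪ N.post e := by
  ext c
  have h₁ : c ∈ N.post e → c ∉ N.preSet (insert e K) := hN.not_mem_preSet_insert hK he
  have h₂ : N.preSet (insert e K) = N.pre e ∪ N.preSet K := by simp [preSet]
  simp only [cut, postSet_insert, h₂, mem_sdiff, mem_union] at h₁ ⊢
  tauto

end IsOccurrenceNet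

theorem exists_maximal_event (hN : N.IsOccurrenceNet) {F : Set T} (hF : F.Finite)
    (hne : F.Nonempty) : ∃ e ∈ F, ∀ f ∈ F, ¬ N.Causal (Sum.inr e) (Sum.inr f) := by
  have : IsStrictOrder T fun e f => N.Causal (Sum.inr f) (Sum.inr e) :=
    { irrefl := fun e => hN.acyclic _
      trans := fun a b c h₁ h₂ => TransGen.trans h₂ h₁ }
  obtain ⟨x, hx⟩ := hne
  obtain ⟨m, -, hm⟩ := (hF.wellFoundedOn
    (r := fun e f => N.Causal (Sum.inr f) (Sum.inr e))).has_min univ ⟨⟨x, hx⟩, mem_univ _⟩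
  exact ⟨m, m.2, fun f hf => hm ⟨f, hf⟩ (mem_univ _)⟩

/-! ### Suffixes of configurations. -/

namespace IsSuffix

variable {K F : Set T}

theorem pre_subset (h : N.IsSuffix K F) {e : T} (he : e ∈ F) :
    N.pre e ⊆ N.cut K ∪ N.postSet F := by
  intro c hc
  by_cases hm : ∃ g ∈ F, c ∈ N.post g
  · exact .inr (mem_postSet.2 hm)
  refine .inl (mem_cut.2 ⟨?_, ?_⟩)
  · by_contra! hcon
    obtain ⟨g, hg⟩ : ∃ g, c ∈ N.post g := by simpa [minConditions, post] using hcon.1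
    rcases h.2.1.2 e (.inr he) g (causal_of_mem_post_of_mem_pre hg hc) with hgK | hgF
    · exact hcon.2 g hgK hg
    · exact hm ⟨g, hgF, hg⟩
  · intro f hf hcf
    obtain rfl := h.2.1.eq_of_mem_pre (.inr he) (.inl hf) hc hcf
    exact disjoint_left.1 h.1 hf he

theorem cut_union (hK : N.IsConfiguration K) (h : N.IsSuffix K F) :
    N.cut (K ∪ F) = (N.cut K ∪ N.postSet F) \ N.preSet F := by
  have h₁ : N.preSet (K ∪ F) = N.preSet K ∪ N.preSet F := biUnion_union _ _ _
  have h₂ : N.postSet (K ∪ F) = N.postSet K ∪ N.postSet F := biUnion_union _ _ _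
  ext c
  have h₃ : c ∈ N.postSet F → c ∉ N.preSet K := by
    rw [mem_postSet, mem_preSet]
    rintro ⟨f, hf, hcf⟩ ⟨k, hk, hck⟩
    exact disjoint_left.1 h.1 (hK.2 k hk f (causal_of_mem_post_of_mem_pre hcf hck)) hf
  simp only [cut, h₁, h₂, mem_sdiff, mem_union]
  tauto

theorem preSet_subset (h : N.IsSuffix K F) : N.preSet F ⊆ N.cut K ∪ N.postSet F :=
  iUnion₂_subset fun _ he => h.pre_subset he

theorem insert_event (hN : N.IsOccurrenceNet) (h : N.IsSuffix K F) {e : T} (he : e ∉ K)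
    (hpre : N.pre e ⊆ N.cut (K ∪ F)) : N.IsSuffix K (insert e F) := by
  refine ⟨disjoint_insert_right.2 ⟨he, h.1⟩, ?_⟩
  rw [union_insert]
  exact ⟨hN.isConfiguration_insert h.2.1 hpre, h.2.2.insert e⟩

/-- A suffix of `K` arises from the empty one by adding enabled events one at a time. -/
theorem induction (hN : N.IsOccurrenceNet) (hK : N.IsConfiguration K) {motive : Set T → Prop}
    (empty : motive ∅)
    (insert : ∀ F e, N.IsSuffix K F → e ∉ K → e ∉ F → N.pre e ⊆ N.cut (K ∪ F) → motive F →
      motive (insert e F))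
    (hF : N.IsSuffix K F) : motive F := by
  induction hn : F.ncard generalizing F with
  | zero =>
    rw [ncard_eq_zero (hF.2.2.subset subset_union_right)] at hn
    exact hn ▸ empty
  | succ n ih =>
    have hfin := hF.2.2.subset subset_union_right
    obtain ⟨e, he, hmax⟩ := exists_maximal_event hN hfin
      (nonempty_of_ncard_ne_zero (by omega))
    have heK : e ∉ K := fun h => disjoint_left.1 hF.1 h he
    -- No event of `F` lies above the maximal event `e`, and none of `K` does because `K` is closed;
    -- so removing `e` keeps causal closure.
    have hF' : N.IsSuffix K (F \ {e}) := by
      refine ⟨hF.1.mono_right sdiff_subset, hF.2.1.subset_of_closed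
        (union_subset_union_right _ sdiff_subset) ?_,
        hF.2.2.subset (union_subset_union_right _ sdiff_subset)⟩
      rintro f (hf | hf) g hg
      · exact .inl (hK.2 f hf g hg)
      · rcases hF.2.1.2 f (.inr hf.1) g hg with hgK | hgF
        · exact .inl hgK
        · exact .inr ⟨hgF, fun h => hmax f hf.1 ((mem_singleton_iff.1 h) ▸ hg)⟩
    have hins : Insert.insert e (F \ {e}) = F := by simp [he]
    rw [← hins]
    refine insert _ e hF' heK (by simp) ?_ (ih hF' ?_)
    · refine hN.pre_subset_cut ?_ (by simp [heK])
      rw [← union_insert, hins]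
      exact hF.2.1
    · rw [ncard_sdiff_singleton_of_mem he, hn]
      rfl

end IsSuffix

theorem IsFinConfiguration.induction (hN : N.IsOccurrenceNet) {motive : Set T → Prop}
    (empty : motive ∅)
    (insert : ∀ K e, N.IsFinConfiguration K → e ∉ K → N.pre e ⊆ N.cut K → motive K →
      motive (insert e K))
    {K : Set T} (hK : N.IsFinConfiguration K) : motive K := by
  refine IsSuffix.induction hN isConfiguration_empty empty (fun F e hF _ heF hpre => ?_)
    (F := K) ⟨empty_disjoint _, by rwa [empty_union]⟩
  have hF' := hF.2
  rw [empty_union] at hpre hF'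
  exact insert F e hF' heF hpre

end PetriNet

/-! ### Images of markings under the labelling. -/

namespace LabelledNet

open Relation Set

variable {P T C E : Type*} {β : LabelledNet P T C E}

/-- No finiteness is needed: `finsum` and `ncard` both default to `0` in the infinite case. -/
theorem mapMarking_indicator (β : LabelledNet P T C E) (A : Set C) (p : P) :
    β.mapMarking (A.indicator 1) p = (A ∩ β.hC ⁻¹' {p}).ncard := by
  have h : β.mapMarking (A.indicator 1) p = ∑ᶠ c ∈ β.hC ⁻¹' {p}, A.indicator 1 c := rfl
  rw [h, finsum_mem_def, ← finsum_one, finsum_mem_def]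
  congr 1
  funext c
  by_cases h₁ : c ∈ A <;> by_cases h₂ : β.hC c = p <;> simp [h₁, h₂]

theorem mapMarking_add {M₁ M₂ : C → ℕ} (h₁ : M₁.support.Finite) (h₂ : M₂.support.Finite) :
    β.mapMarking (M₁ + M₂) = β.mapMarking M₁ + β.mapMarking M₂ := by
  funext p
  exact finsum_mem_add_distrib' (s := β.hC ⁻¹' {p}) (h₁.subset inter_subset_right)
    (h₂.subset inter_subset_right)

theorem le_mapMarking (β : LabelledNet P T C E) {M : C → ℕ} (hM : M.support.Finite) (c : C) :
    M c ≤ β.mapMarking M (β.hC c) := by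
  have h : β.mapMarking M (β.hC c) = ∑ᶠ d, (β.hC ⁻¹' {β.hC c}).indicator M d :=
    finsum_mem_def (β.hC ⁻¹' {β.hC c}) M
  rw [h]
  have hf : ((β.hC ⁻¹' {β.hC c}).indicator M).support.Finite := by
    rw [support_indicator]
    exact hM.subset inter_subset_right
  refine le_of_eq_of_le ?_ (single_le_finsum c hf fun _ => Nat.zero_le _)
  simp

theorem ncard_fiber_of_bijOn {A : Set C} {Q : Set P} (h : BijOn β.hC A Q) (p : P) :
    (A ∩ β.hC ⁻¹' {p}).ncard = Q.indicator 1 p := by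
  by_cases hp : p ∈ Q
  · obtain ⟨c, hc, rfl⟩ := h.surjOn hp
    have : A ∩ β.hC ⁻¹' {β.hC c} = {c} := by
      ext d
      constructor
      · rintro ⟨hd, hdc⟩
        exact h.injOn hd hc hdc
      · rintro rfl
        exact ⟨hc, rfl⟩
    simp [this, hp]
  · have : A ∩ β.hC ⁻¹' {p} = ∅ := by
      ext d
      simp only [mem_inter_iff, mem_preimage, mem_singleton_iff, mem_empty_iff_false, iff_false]
      rintro ⟨hd, rfl⟩
      exact hp (h.mapsTo hd)
    simp [this, hp]

theorem mapMarking_indicator_of_bijOn {A : Set C} {Q : Set P} (h : BijOn β.hC A Q) :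
    β.mapMarking (A.indicator 1) = Q.indicator 1 := by
  funext p
  rw [mapMarking_indicator, ncard_fiber_of_bijOn h]

theorem mapMarking_indicator_eq_of_bijOn {A B : Set C} {γ : C → C} (h : BijOn γ A B)
    (hl : ∀ c ∈ A, β.hC (γ c) = β.hC c) :
    β.mapMarking (A.indicator 1) = β.mapMarking (B.indicator 1) := by
  funext p
  rw [mapMarking_indicator, mapMarking_indicator]
  refine BijOn.ncard_eq (f := γ) ⟨?_, h.injOn.mono inter_subset_left, ?_⟩
  · rintro c ⟨hc, hp⟩
    exact ⟨h.mapsTo hc, (hl c hc).trans hp⟩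
  · rintro d ⟨hd, hp⟩
    obtain ⟨c, hc, rfl⟩ := h.surjOn hd
    exact ⟨c, ⟨hc, (hl c hc).symm.trans hp⟩, rfl⟩

/-- Fibres over each label are equinumerous, so bijections are chosen label by label and glued. The
choice is not canonical when a label occurs several times. -/
theorem exists_bijOn_of_mapMarking_indicator_eq {A B : Set C} (hA : A.Finite) (hB : B.Finite)
    (h : β.mapMarking (A.indicator 1) = β.mapMarking (B.indicator 1)) :
    ∃ γ : C → C, BijOn γ A B ∧ ∀ c ∈ A, β.hC (γ c) = β.hC c := by
  have key : ∀ p, ∃ γ : C → C, BijOn γ (A ∩ β.hC ⁻¹' {p}) (B ∩ β.hC ⁻¹' {p}) := by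
    intro p
    have hp := congrFun h p
    rw [mapMarking_indicator, mapMarking_indicator] at hp
    have hA' := hA.subset (inter_subset_left (t := β.hC ⁻¹' {p}))
    have hB' := hB.subset (inter_subset_left (t := β.hC ⁻¹' {p}))
    rcases isEmpty_or_nonempty C with hC | hC
    · exact ⟨id, by simp [Set.eq_empty_of_isEmpty]⟩
    · refine hA'.exists_bijOn_of_encard_eq ?_
      rw [← hA'.cast_ncard_eq, ← hB'.cast_ncard_eq, hp]
  choose γ hγ using key
  have hl : ∀ c ∈ A, β.hC (γ (β.hC c) c) = β.hC c := fun c hc =>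
    ((hγ (β.hC c)).mapsTo ⟨hc, rfl⟩).2
  refine ⟨fun c => γ (β.hC c) c, ⟨?_, ?_, ?_⟩, hl⟩
  · exact fun c hc => ((hγ (β.hC c)).mapsTo ⟨hc, rfl⟩).1
  · intro c hc d hd hcd
    have hcd' : β.hC c = β.hC d := by
      rw [← hl c hc, ← hl d hd]
      exact congrArg β.hC hcd
    refine (hγ (β.hC c)).injOn ⟨hc, rfl⟩ ⟨hd, hcd'.symm⟩ ?_
    simpa only [hcd'] using hcd
  · intro d hd
    obtain ⟨c, ⟨hc, hcd⟩, hγc⟩ := (hγ (β.hC d)).surjOn ⟨hd, rfl⟩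
    change β.hC c = _ at hcd
    exact ⟨c, hc, by simpa only [hcd] using hγc⟩

section Homomorphism

variable [Finite P] {S : NetSystem P T}

/-- The firing equation is additive, and the preset and postset of `e` map bijectively, so the
equation passes to images. Assuming only these bijections lets the lemma serve both the unfolding
and its prefix. Finite support is carried along because `finsum` is additive only there. -/
theorem mapMarking_fires {M M' : C → ℕ} {e : E}
    (hpre : BijOn β.hC (β.net.pre e) (S.net.pre (β.hE e)))
    (hpost : BijOn β.hC (β.net.post e) (S.net.post (β.hE e)))
    (hM : M.support.Finite) (h : β.net.Fires M e M') :
    M'.support.Finite ∧ S.net.Fires (β.mapMarking M) (β.hE e) (β.mapMarking M') := by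
  have hfpre : (β.net.pre e).Finite := hpre.finite_iff_finite.2 (toFinite _)
  have hfpost : (β.net.post e).Finite := hpost.finite_iff_finite.2 (toFinite _)
  have hs : ∀ A : Set C, A.Finite → (A.indicator (1 : C → ℕ)).support.Finite := fun A hA =>
    hA.subset support_indicator_subset
  have hM' : M'.support.Finite := by
    refine (hM.union hfpost).subset fun c hc => ?_
    by_contra hcon
    simp only [mem_union, Function.mem_support, not_or, not_not] at hcon hc
    have := h.2 c
    rw [hcon.1, indicator_of_notMem hcon.2] at this
    omega
  refine ⟨hM', ?_, ?_⟩
  · intro p hp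
    obtain ⟨c, hc, rfl⟩ := hpre.surjOn hp
    have h₁ : 1 ≤ M c := h.1 c hc
    have h₂ : M c ≤ β.mapMarking M (β.hC c) :=
      le_mapMarking β hM c
    exact h₁.trans h₂
  · have heq : M' + (β.net.pre e).indicator 1 = M + (β.net.post e).indicator 1 := funext h.2
    have := congrArg β.mapMarking heq
    rw [mapMarking_add hM' (hs _ hfpre), mapMarking_add hM (hs _ hfpost),
      mapMarking_indicator_of_bijOn hpre, mapMarking_indicator_of_bijOn hpost] at this
    exact congrFun this

theorem mapMarking_reachable
    (hpre : ∀ e, BijOn β.hC (β.net.pre e) (S.net.pre (β.hE e)))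
    (hpost : ∀ e, BijOn β.hC (β.net.post e) (S.net.post (β.hE e)))
    (hfin : β.net.minConditions.Finite) (hmin : β.mapMarking β.net.minMarking = S.M₀)
    {M : C → ℕ} (h : β.ReachableMarking M) :
    M.support.Finite ∧ S.net.Reachable S.M₀ (β.mapMarking M) := by
  induction h with
  | refl => exact ⟨hfin.subset support_indicator_subset, hmin ▸ .refl⟩
  | tail _ h ih =>
    obtain ⟨e, he⟩ := h
    have := mapMarking_fires (hpre e) (hpost e) ih.1 he
    exact ⟨this.1, ih.2.tail ⟨_, this.2⟩⟩

end Homomorphism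

end LabelledNet

/-! ### The firing rule and its effect on cuts. -/

namespace PetriNet

variable {P T : Type*} {N : PetriNet P T}

theorem Fires.unique {M M₁ M₂ : P → ℕ} {t : T} (h₁ : N.Fires M t M₁) (h₂ : N.Fires M t M₂) :
    M₁ = M₂ :=
  funext fun p => Nat.add_right_cancel ((h₁.2 p).trans (h₂.2 p).symm)

theorem Enabled.exists_fires {M : P → ℕ} {t : T} (h : N.Enabled M t) : ∃ M', N.Fires M t M' := by
  refine ⟨fun p => M p + (N.post t).indicator 1 p - (N.pre t).indicator 1 p, h, fun p => ?_⟩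
  by_cases hp : p ∈ N.pre t
  · have := h p hp
    simp only [Set.indicator_of_mem hp, Pi.one_apply]
    omega
  · simp [hp]

theorem IsOccurrenceNet.fires_cut {K : Set T} {e : T} (hN : N.IsOccurrenceNet)
    (hK : N.IsConfiguration K) (he : e ∉ K) (hpre : N.pre e ⊆ N.cut K) :
    N.Fires ((N.cut K).indicator 1) e ((N.cut (insert e K)).indicator 1) := by
  refine ⟨fun c hc => by simp [hpre hc], fun c => ?_⟩
  have h₁ := @hpre c
  have h₂ : c ∈ N.post e → c ∉ N.cut K :=
    fun h => Set.disjoint_left.1 (hN.disjoint_post_cut he) h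
  rw [hN.cut_insert hK he]
  by_cases h₃ : c ∈ N.pre e <;> by_cases h₄ : c ∈ N.post e <;> by_cases h₅ : c ∈ N.cut K <;>
    simp_all

end PetriNet

/-! ### Extending a branching process by one event. -/

namespace LabelledNet

open Relation Set

variable {P T C E Q : Type*}

/-- The labelled net `β` with one more event, labelled `t`, which consumes the conditions in `X`
and produces the new conditions `Q`, labelled by `q`. -/
def addEvent (β : LabelledNet P T C E) (X : Set C) (t : T) (q : Q → P) :
    LabelledNet P T (C ⊕ Q) (Option E) where
  net :=
    { arcPT := fun c e => Sum.elim (fun c => e.elim (c ∈ X) (β.net.arcPT c)) (fun _ => False) c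
      arcTP := fun e c => e.elim (Sum.elim (fun _ => False) (fun _ => True) c)
        fun e => Sum.elim (β.net.arcTP e) (fun _ => False) c }
  hC := Sum.elim β.hC q
  hE := fun e => e.elim t β.hE

variable {β : LabelledNet P T C E} {X : Set C} {t : T} {q : Q → P}

/-- The embedding of the nodes of `β` into those of `β.addEvent X t q`. -/
abbrev addEventNode (Q : Type*) : C ⊕ E → (C ⊕ Q) ⊕ Option E := Sum.map Sum.inl some

theorem addEvent_pre_some (e : E) :
    (β.addEvent X t q).net.pre (some e) = Sum.inl '' β.net.pre e := by
  ext (c | c) <;> simp [addEvent, PetriNet.pre]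

theorem addEvent_post_some (e : E) :
    (β.addEvent X t q).net.post (some e) = Sum.inl '' β.net.post e := by
  ext (c | c) <;> simp [addEvent, PetriNet.post]

theorem addEvent_pre_none : (β.addEvent X t q).net.pre none = Sum.inl '' X := by
  ext (c | c) <;> simp [addEvent, PetriNet.pre]

theorem addEvent_post_none : (β.addEvent X t q).net.post none = range Sum.inr := by
  ext (c | c) <;> simp [addEvent, PetriNet.post]

theorem addEvent_minConditions :
    (β.addEvent X t q).net.minConditions = Sum.inl '' β.net.minConditions := by
  ext (c | c) <;> simp [addEvent, PetriNet.minConditions, Option.forall]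

/-- The new event points only to new conditions, so old nodes keep their past. -/
theorem addEvent_arc_node {y : (C ⊕ Q) ⊕ Option E} {x : C ⊕ E} :
    (β.addEvent X t q).net.Arc y (addEventNode Q x) ↔
      ∃ z, y = addEventNode Q z ∧ β.net.Arc z x := by
  rcases y with (c | c) | (_ | e) <;> rcases x with d | f <;>
    simp [addEvent, PetriNet.Arc]

theorem addEvent_arc_none {y : (C ⊕ Q) ⊕ Option E} :
    (β.addEvent X t q).net.Arc y (Sum.inr none) ↔
      ∃ c ∈ X, y = addEventNode Q (Sum.inl c) := by
  rcases y with (c | c) | (_ | e) <;> simp [addEvent, PetriNet.Arc]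

theorem addEvent_arc_inr {y : (C ⊕ Q) ⊕ Option E} {c : Q} :
    (β.addEvent X t q).net.Arc y (Sum.inl (Sum.inr c)) ↔ y = Sum.inr none := by
  rcases y with (c | c) | (_ | e) <;> simp [addEvent, PetriNet.Arc]

theorem addEvent_reflTransGen_node {y : (C ⊕ Q) ⊕ Option E} {x : C ⊕ E}
    (h : ReflTransGen (β.addEvent X t q).net.Arc y (addEventNode Q x)) :
    ∃ z, y = addEventNode Q z ∧ ReflTransGen β.net.Arc z x := by
  induction h using ReflTransGen.head_induction_on with
  | refl => exact ⟨x, rfl, .refl⟩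
  | head h _ ih =>
    obtain ⟨z, rfl, hz⟩ := ih
    obtain ⟨w, rfl, hw⟩ := addEvent_arc_node.1 h
    exact ⟨w, rfl, .head hw hz⟩

theorem addEvent_causal_node {y : (C ⊕ Q) ⊕ Option E} {x : C ⊕ E}
    (h : (β.addEvent X t q).net.Causal y (addEventNode Q x)) :
    ∃ z, y = addEventNode Q z ∧ β.net.Causal z x := by
  obtain ⟨w, hyw, hwx⟩ := TransGen.tail'_iff.1 h
  obtain ⟨w, rfl, hw⟩ := addEvent_arc_node.1 hwx
  obtain ⟨z, rfl, hz⟩ := addEvent_reflTransGen_node hyw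
  exact ⟨z, rfl, TransGen.tail' hz hw⟩

theorem addEvent_causal_none {y : (C ⊕ Q) ⊕ Option E}
    (h : (β.addEvent X t q).net.Causal y (Sum.inr none)) :
    ∃ c ∈ X, ∃ z, y = addEventNode Q z ∧ ReflTransGen β.net.Arc z (Sum.inl c) := by
  obtain ⟨w, hyw, hw⟩ := TransGen.tail'_iff.1 h
  obtain ⟨c, hc, rfl⟩ := addEvent_arc_none.1 hw
  exact ⟨c, hc, addEvent_reflTransGen_node hyw⟩

theorem addEvent_causal_inr {y : (C ⊕ Q) ⊕ Option E} {c : Q}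
    (h : (β.addEvent X t q).net.Causal y (Sum.inl (Sum.inr c))) :
    ReflTransGen (β.addEvent X t q).net.Arc y (Sum.inr none) := by
  obtain ⟨w, hyw, hw⟩ := TransGen.tail'_iff.1 h
  rwa [addEvent_arc_inr.1 hw] at hyw

theorem addEvent_le_none {f : Option E}
    (h : ReflTransGen (β.addEvent X t q).net.Arc (Sum.inr f) (Sum.inr none)) :
    f = none ∨ ∃ e, f = some e ∧ ∃ c ∈ X, ReflTransGen β.net.Arc (Sum.inr e) (Sum.inl c) := by
  rcases PetriNet.reflTransGen_inr_iff.1 h with h | h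
  · exact .inl h
  · obtain ⟨c, hc, z | e, hz, hzc⟩ := addEvent_causal_none h
    · cases hz
    · exact .inr ⟨e, Sum.inr_injective hz, c, hc, hzc⟩

section

variable {K : Set E}

/-- Old events below the new one belong to `K`, which is conflict-free and consumes nothing from its
own cut. -/
theorem addEvent_not_conflict_none (hβ : β.net.IsOccurrenceNet) (hK : β.net.IsConfiguration K)
    (hX : X ⊆ β.net.cut K) :
    ¬ (β.addEvent X t q).net.Conflict (Sum.inr none) (Sum.inr none) := by
  have key : ∀ (s : C) (e : E), s ∈ X → s ∈ β.net.pre e →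
      (∃ c ∈ X, ReflTransGen β.net.Arc (Sum.inr e) (Sum.inl c)) → False := by
    rintro s e hs hse ⟨c, hc, hec⟩
    exact (PetriNet.mem_cut.1 (hX hs)).2 e (hβ.mem_of_le_cut hK (hX hc) hec) hse
  rintro ⟨s | s, t₁, t₂, hne, h₁, h₂, h₃, h₄⟩
  · rcases addEvent_le_none h₃ with rfl | ⟨e₁, rfl, c₁, hc₁, hec₁⟩ <;>
      rcases addEvent_le_none h₄ with rfl | ⟨e₂, rfl, c₂, hc₂, hec₂⟩
    · exact hne rfl
    · exact key s e₂ h₁ h₂ ⟨c₂, hc₂, hec₂⟩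
    · exact key s e₁ h₂ h₁ ⟨c₁, hc₁, hec₁⟩
    · exact hne (congrArg some (hK.eq_of_mem_pre (hβ.mem_of_le_cut hK (hX hc₁) hec₁)
        (hβ.mem_of_le_cut hK (hX hc₂) hec₂) h₁ h₂))
  · exact h₁.elim

theorem addEvent_isOccurrenceNet (hβ : β.net.IsOccurrenceNet) (hK : β.net.IsConfiguration K)
    (hX : X ⊆ β.net.cut K) (hXfin : X.Finite) :
    (β.addEvent X t q).net.IsOccurrenceNet := by
  have cases_node : ∀ x : (C ⊕ Q) ⊕ Option E,
      (∃ z, x = addEventNode Q z) ∨ x = Sum.inr none ∨ ∃ c, x = Sum.inl (Sum.inr c) := by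
    rintro ((c | c) | (_ | e))
    · exact .inl ⟨Sum.inl c, rfl⟩
    · exact .inr (.inr ⟨c, rfl⟩)
    · exact .inr (.inl rfl)
    · exact .inl ⟨Sum.inr e, rfl⟩
  have hinj : Function.Injective (addEventNode Q : C ⊕ E → _) :=
    Sum.map_injective.2 ⟨Sum.inl_injective, Option.some_injective E⟩
  have hnone : {y | (β.addEvent X t q).net.Causal y (Sum.inr none)}.Finite := by
    refine (hXfin.biUnion fun c _ => ((hβ.finite_past (Sum.inl c)).insert
      (Sum.inl c)).image (addEventNode Q)).subset fun y hy => ?_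
    obtain ⟨c, hc, z, rfl, hz⟩ := addEvent_causal_none hy
    refine mem_iUnion₂.2 ⟨c, hc, z, ?_, rfl⟩
    rcases reflTransGen_iff_eq_or_transGen.1 hz with h | h
    · exact .inl h.symm
    · exact .inr h
  refine ⟨fun x hx => ?_, ?_, fun x hx => ?_, fun x => ?_⟩
  · rcases cases_node x with ⟨z, rfl⟩ | rfl | ⟨c, rfl⟩
    · obtain ⟨w, hw, hwz⟩ := addEvent_causal_node hx
      obtain rfl := hinj hw
      exact hβ.acyclic _ hwz
    · obtain ⟨c, -, z | z, hz, -⟩ := addEvent_causal_none hx <;> cases hz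
    · rcases reflTransGen_iff_eq_or_transGen.1 (addEvent_causal_inr hx) with h | h
      · cases h
      · obtain ⟨c, -, z | z, hz, -⟩ := addEvent_causal_none h <;> cases hz
  · rintro (c | c) (_ | e) (_ | e') h h'
    · rfl
    · exact h.elim
    · exact h'.elim
    · exact congrArg some (hβ.pre_condition c e e' h h')
    · rfl
    · exact h'.elim
    · exact h.elim
    · exact h.elim
  · rcases cases_node x with ⟨z, rfl⟩ | rfl | ⟨c, rfl⟩
    · obtain ⟨s, t₁, t₂, hne, h₁, h₂, h₃, h₄⟩ := hx
      obtain ⟨z₁ | e₁, hz₁, h₃'⟩ := addEvent_reflTransGen_node h₃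
      · cases hz₁
      obtain ⟨z₂ | e₂, hz₂, h₄'⟩ := addEvent_reflTransGen_node h₄
      · cases hz₂
      obtain rfl := Sum.inr_injective hz₁
      obtain rfl := Sum.inr_injective hz₂
      rcases s with s | s
      · exact hβ.no_self_conflict z ⟨s, e₁, e₂, fun h => hne (congrArg some h), h₁, h₂, h₃', h₄'⟩
      · exact h₁.elim
    · exact addEvent_not_conflict_none hβ hK hX hx
    · refine addEvent_not_conflict_none (t := t) (q := q) hβ hK hX ?_
      obtain ⟨s, t₁, t₂, hne, h₁, h₂, h₃, h₄⟩ := hx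
      have le : ∀ f : Option E, ReflTransGen (β.addEvent X t q).net.Arc (Sum.inr f)
          (Sum.inl (Sum.inr c)) → ReflTransGen (β.addEvent X t q).net.Arc (Sum.inr f)
          (Sum.inr none) := fun f hf =>
        (reflTransGen_iff_eq_or_transGen.1 hf).elim (fun h => by cases h) addEvent_causal_inr
      exact ⟨s, t₁, t₂, hne, h₁, h₂, le _ h₃, le _ h₄⟩
  · rcases cases_node x with ⟨z, rfl⟩ | rfl | ⟨c, rfl⟩
    · refine ((hβ.finite_past z).image (addEventNode Q)).subset fun y hy => ?_
      obtain ⟨w, rfl, hw⟩ := addEvent_causal_node hy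
      exact ⟨w, hw, rfl⟩
    · exact hnone
    · refine (hnone.insert (Sum.inr none)).subset fun y hy => ?_
      rcases reflTransGen_iff_eq_or_transGen.1 (addEvent_causal_inr hy) with h | h
      · exact .inl h.symm
      · exact .inr h

theorem addEvent_isBranching {S : NetSystem P T} (hβ : β.IsBranching S)
    (hK : β.net.IsConfiguration K) (hX : X ⊆ β.net.cut K) (hXfin : X.Finite)
    (hpre : BijOn β.hC X (S.net.pre t)) (hq : BijOn q univ (S.net.post t))
    (hnew : ∀ e, β.hE e = t → β.net.pre e ≠ X) :
    (β.addEvent X t q).IsBranching S := by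
  have himg : ∀ {A : Set C} {B : Set P}, BijOn β.hC A B →
      BijOn (β.addEvent X t q).hC (Sum.inl '' A) B := fun h =>
    (bijOn_comp_iff Sum.inl_injective.injOn).1 h
  refine ⟨addEvent_isOccurrenceNet hβ.occ hK hX hXfin, ?_, ?_, ?_, ?_, ?_⟩
  · rintro (_ | e)
    · rw [addEvent_pre_none]
      exact himg hpre
    · rw [addEvent_pre_some]
      exact himg (hβ.pre_bij e)
  · rintro (_ | e)
    · rw [addEvent_post_none, ← image_univ]
      exact (bijOn_comp_iff Sum.inr_injective.injOn).1 hq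
    · rw [addEvent_post_some]
      exact himg (hβ.post_bij e)
  · rw [addEvent_minConditions]
    exact hβ.min_finite.image _
  · rw [← hβ.min_eq]
    funext p
    rw [PetriNet.minMarking, PetriNet.minMarking, mapMarking_indicator, mapMarking_indicator,
      addEvent_minConditions,
      ← ncard_image_of_injective (β.net.minConditions ∩ _) (Sum.inl_injective (β := Q))]
    refine congrArg ncard ?_
    ext (c | c) <;> simp [addEvent]
  · rintro (_ | e) (_ | e') hl hp
    · rfl
    · rw [addEvent_pre_none, addEvent_pre_some] at hp
      exact (hnew e' hl.symm (Sum.inl_injective.image_injective hp).symm).elim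
    · rw [addEvent_pre_none, addEvent_pre_some] at hp
      exact (hnew e hl (Sum.inl_injective.image_injective hp)).elim
    · rw [addEvent_pre_some, addEvent_pre_some] at hp
      exact congrArg some (hβ.event_ext e e' hl (Sum.inl_injective.image_injective hp))

end

theorem isPrefixEmbedding_addEvent :
    β.IsPrefixEmbedding (β.addEvent X t q) Sum.inl some where
  inj_condition := Sum.inl_injective
  inj_event := Option.some_injective E
  label_condition _ := rfl
  label_event _ := rfl
  pre_eq := addEvent_pre_some
  post_eq := addEvent_post_some
  closed := by
    rintro c (_ | e) h
    · exact h.elim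
    · exact ⟨e, rfl⟩

/-- In an unfolding, every occurrence of a preset in a cut is consumed by some event. -/
theorem IsUnfolding.exists_event.{uC} {C : Type uC} {β : LabelledNet P T C E} {X : Set C}
    [Finite P] {S : NetSystem P T} (hβ : β.IsUnfolding S)
    {K : Set E} (hK : β.net.IsConfiguration K) (hX : X ⊆ β.net.cut K)
    (hpre : BijOn β.hC X (S.net.pre t)) : ∃ e, β.hE e = t ∧ β.net.pre e = X := by
  by_contra! hnew
  -- Maximality quantifies only over condition types in the universe of `C`; `Shrink` moves the
  -- finite postset there.
  let i : S.net.post t ≃ Shrink.{uC} (S.net.post t) := equivShrink _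
  have hq : BijOn (fun x => (i.symm x : P)) univ (S.net.post t) :=
    ⟨fun x _ => (i.symm x).2, (Subtype.val_injective.comp i.symm.injective).injOn,
      fun p hp => ⟨i ⟨p, hp⟩, mem_univ _, by simp⟩⟩
  -- Maximality makes `some` surjective, yet it misses the new event `none`.
  obtain ⟨e, he⟩ := (hβ.2 _ _ _ _ _ (addEvent_isBranching hβ.1 hK hX
    (hpre.finite_iff_finite.2 (toFinite _)) hpre hq hnew) isPrefixEmbedding_addEvent).2 none
  cases he

end LabelledNet

/-! ### Restricting and gluing bijections. -/

namespace Set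

theorem BijOn.sdiff_image {α β : Type*} {f : α → β} {s u : Set α} {t : Set β}
    (h : BijOn f s t) (hu : u ⊆ s) : BijOn f (s \ u) (t \ f '' u) := by
  refine ⟨fun a ha => ⟨h.mapsTo ha.1, ?_⟩, h.injOn.mono sdiff_subset, ?_⟩
  · rintro ⟨b, hb, hba⟩
    exact ha.2 (h.injOn (hu hb) ha.1 hba ▸ hb)
  · rintro b ⟨hb, hbu⟩
    obtain ⟨a, ha, rfl⟩ := h.surjOn hb
    exact ⟨a, ⟨ha, fun hau => hbu ⟨a, hau, rfl⟩⟩, rfl⟩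

theorem BijOn.exists_union {α β : Type*} {f g : α → β} {s₁ s₂ : Set α} {t₁ t₂ : Set β}
    (hf : BijOn f s₁ t₁) (hg : BijOn g s₂ t₂) (hs : Disjoint s₁ s₂) (ht : Disjoint t₁ t₂) :
    ∃ k : α → β, EqOn k f s₁ ∧ EqOn k g s₂ ∧ BijOn k (s₁ ∪ s₂) (t₁ ∪ t₂) := by
  classical
  have h₁ : EqOn (s₁.piecewise f g) f s₁ := piecewise_eqOn s₁ f g
  have h₂ : EqOn (s₁.piecewise f g) g s₂ := fun a ha =>
    piecewise_eq_of_notMem _ _ _ (disjoint_right.1 hs ha)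
  have hf' := hf.congr h₁.symm
  have hg' := hg.congr h₂.symm
  refine ⟨s₁.piecewise f g, h₁, h₂, hf'.union hg' ((injOn_union hs).2
    ⟨hf'.injOn, hg'.injOn, fun a ha b hb hab => ?_⟩)⟩
  exact disjoint_left.1 ht (hf'.mapsTo ha) (hab ▸ hg'.mapsTo hb)

end Set

/-! ### Transport of suffixes and completeness. -/

namespace LabelledNet

open Relation Set

variable {P T C E : Type*} {β : LabelledNet P T C E} {S : NetSystem P T}

theorem mark_empty (hβ : β.IsBranching S) : β.mark ∅ = S.M₀ := by
  rw [mark, PetriNet.cut_empty]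
  exact hβ.min_eq

namespace IsBranching

theorem finite_post [Finite P] (hβ : β.IsBranching S) (e : E) : (β.net.post e).Finite :=
  (hβ.post_bij e).finite_iff_finite.2 (toFinite _)

theorem finite_cut [Finite P] (hβ : β.IsBranching S) {K : Set E} (hK : K.Finite) :
    (β.net.cut K).Finite :=
  (hβ.min_finite.union (hK.biUnion fun e _ => hβ.finite_post e)).subset sdiff_subset

theorem fires_mark [Finite P] (hβ : β.IsBranching S) {K : Set E} {e : E}
    (hK : β.net.IsFinConfiguration K) (he : e ∉ K) (hpre : β.net.pre e ⊆ β.net.cut K) :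
    S.net.Fires (β.mark K) (β.hE e) (β.mark (insert e K)) :=
  (mapMarking_fires (hβ.pre_bij e) (hβ.post_bij e)
    ((hβ.finite_cut hK.2).subset support_indicator_subset)
    (hβ.occ.fires_cut hK.1 he hpre)).2

end IsBranching

/-- With an empty preset the inclusion is vacuous and holds even for events already in `K`. -/
theorem not_mem_of_pre_subset_cut {K : Set E} {e : E} (hne : (β.net.pre e).Nonempty)
    (hpre : β.net.pre e ⊆ β.net.cut K) : e ∉ K := fun he =>
  let ⟨_, hc⟩ := hne
  (PetriNet.mem_cut.1 (hpre hc)).2 e he hc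

/-- The data of a suffix isomorphism restricts to a bijection between the resulting cuts. -/
theorem bijOn_cut_union {K₁ F₁ K₂ F₂ : Set E} (hK₁ : β.net.IsConfiguration K₁)
    (hK₂ : β.net.IsConfiguration K₂) (h₁ : β.net.IsSuffix K₁ F₁) (h₂ : β.net.IsSuffix K₂ F₂)
    {γ : C → C} {φ : E → E} (hφ : BijOn φ F₁ F₂)
    (hγ : BijOn γ (β.net.cut K₁ ∪ β.net.postSet F₁) (β.net.cut K₂ ∪ β.net.postSet F₂))
    (hpre : ∀ e ∈ F₁, β.net.pre (φ e) = γ '' β.net.pre e) :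
    BijOn γ (β.net.cut (K₁ ∪ F₁)) (β.net.cut (K₂ ∪ F₂)) := by
  have hF : β.net.preSet F₂ = γ '' β.net.preSet F₁ := by
    rw [PetriNet.preSet, PetriNet.preSet, ← hφ.image_eq, biUnion_image, image_iUnion₂]
    exact iUnion₂_congr hpre
  rw [h₁.cut_union hK₁, h₂.cut_union hK₂, hF]
  exact hγ.sdiff_image h₁.preSet_subset

theorem SuffixIso.mark_eq {K₁ F₁ K₂ F₂ : Set E} (h : β.SuffixIso K₁ F₁ K₂ F₂)
    (hK₁ : β.net.IsConfiguration K₁) (hK₂ : β.net.IsConfiguration K₂)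
    (h₁ : β.net.IsSuffix K₁ F₁) (h₂ : β.net.IsSuffix K₂ F₂) :
    β.mark (K₁ ∪ F₁) = β.mark (K₂ ∪ F₂) := by
  obtain ⟨γ, φ, hφ, hγ, hl, he⟩ := h
  refine mapMarking_indicator_eq_of_bijOn
    (bijOn_cut_union hK₁ hK₂ h₁ h₂ hφ hγ fun e hF => (he e hF).2.1) fun c hc => hl c ?_
  rw [h₁.cut_union hK₁] at hc
  exact hc.1

namespace IsUnfolding

theorem exists_event_of_enabled [Finite P] (hβ : β.IsUnfolding S) {K : Set E}
    (hK : β.net.IsConfiguration K) {t : T} (ht : S.net.Enabled (β.mark K) t) :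
    ∃ e, β.hE e = t ∧ β.net.pre e ⊆ β.net.cut K := by
  have hs : SurjOn β.hC (β.net.cut K) (S.net.pre t) := by
    intro p hp
    have := ht p hp
    rw [mark, mapMarking_indicator] at this
    obtain ⟨c, hc, hcp⟩ := nonempty_of_ncard_ne_zero (Nat.one_le_iff_ne_zero.1 this)
    exact ⟨c, hc, hcp⟩
  obtain ⟨X, hX, hbij⟩ := hs.exists_bijOn_subset
  obtain ⟨e, he, rfl⟩ := hβ.exists_event hK hX hbij
  exact ⟨e, he, hX⟩

theorem exists_configuration [Finite P] (hβ : β.IsUnfolding S)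
    (hS : ∀ t, S.net.pre t = ∅ → S.net.post t = ∅) {M : P → ℕ} (hM : S.net.Reachable S.M₀ M) :
    ∃ K, β.net.IsFinConfiguration K ∧ β.mark K = M := by
  induction hM with
  | refl => exact ⟨∅, ⟨PetriNet.isConfiguration_empty, finite_empty⟩, mark_empty hβ.1⟩
  | tail _ h ih =>
    obtain ⟨t, ht⟩ := h
    obtain ⟨K, hK, rfl⟩ := ih
    -- The only event for a transition without inputs may already be in `K`; but by `hS` the marking
    -- does not change, so `K` is kept.
    rcases (S.net.pre t).eq_empty_or_nonempty with h | h
    · refine ⟨K, hK, funext fun p => ?_⟩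
      simpa [h, hS t h] using (ht.2 p).symm
    · obtain ⟨e, rfl, hpre⟩ := hβ.exists_event_of_enabled hK.1 ht.1
      have hne : (β.net.pre e).Nonempty := by
        obtain ⟨p, hp⟩ := h
        obtain ⟨c, hc, -⟩ := (hβ.1.pre_bij e).surjOn hp
        exact ⟨c, hc⟩
      exact ⟨insert e K, ⟨hβ.1.occ.isConfiguration_insert hK.1 hpre, hK.2.insert e⟩,
        (hβ.1.fires_mark hK (not_mem_of_pre_subset_cut hne hpre) hpre).unique ht⟩

/-- The suffix is copied event by event. The bijection between the current cuts pulls the preset of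
the next event back to a set `X`, maximality supplies an event consuming `X`, and the postsets are
matched by labels. Nonempty presets ensure that this event has not been used before. -/
theorem exists_suffixIso [Finite P] (hβ : β.IsUnfolding S) {K₁ K₂ : Set E}
    (hK₁ : β.net.IsFinConfiguration K₁) (hK₂ : β.net.IsFinConfiguration K₂)
    (hm : β.mark K₁ = β.mark K₂) {F₂ : Set E} (hF₂ : β.net.IsSuffix K₂ F₂)
    (hne : ∀ e ∈ F₂, (β.net.pre e).Nonempty) :
    ∃ F₁, β.net.IsSuffix K₁ F₁ ∧ β.SuffixIso K₁ F₁ K₂ F₂ := by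
  have hocc := hβ.1.occ
  refine PetriNet.IsSuffix.induction (motive := fun F => (∀ e ∈ F, (β.net.pre e).Nonempty) →
    ∃ F₁, β.net.IsSuffix K₁ F₁ ∧ β.SuffixIso K₁ F₁ K₂ F) hocc hK₂.1 (fun _ => ?_) ?_ hF₂ hne
  · obtain ⟨γ, hγ, hl⟩ := exists_bijOn_of_mapMarking_indicator_eq (hβ.1.finite_cut hK₁.2)
      (hβ.1.finite_cut hK₂.2) hm
    exact ⟨∅, ⟨disjoint_empty _, by rwa [union_empty]⟩, γ, id, bijOn_empty _,
      by simpa using hγ, by simpa using hl, fun _ h => h.elim⟩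
  clear hne hF₂ F₂
  intro F₂ e hF₂ heK heF hpre ih hne
  obtain ⟨F₁, hF₁, γ, φ, hφ, hγ, hl, hφe⟩ := ih fun f hf => hne f (.inr hf)
  have hcut := bijOn_cut_union hK₁.1 hK₂.1 hF₁ hF₂ hφ hγ fun f hf => (hφe f hf).2.1
  have hcut_sub : β.net.cut (K₁ ∪ F₁) ⊆ β.net.cut K₁ ∪ β.net.postSet F₁ := by
    rw [hF₁.cut_union hK₁.1]
    exact sdiff_subset
  obtain ⟨X, hX, hXe⟩ := (hcut.surjOn.mono Subset.rfl hpre).exists_bijOn_subset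
  have hXt : BijOn β.hC X (S.net.pre (β.hE e)) :=
    ((hβ.1.pre_bij e).comp hXe).congr fun c hc => hl c (hcut_sub (hX hc))
  obtain ⟨x, hxe, rfl⟩ := hβ.exists_event hF₁.2.1 hX hXt
  have hxne : (β.net.pre x).Nonempty := by
    obtain ⟨d, hd⟩ := hne e (.inl rfl)
    obtain ⟨c, hc, -⟩ := hXe.surjOn hd
    exact ⟨c, hc⟩
  have hx := not_mem_of_pre_subset_cut hxne hX
  have hxK : x ∉ K₁ := fun h => hx (.inl h)
  have hxF : x ∉ F₁ := fun h => hx (.inr h)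
  have hdisj : ∀ {K F : Set E} {y : E}, y ∉ K → y ∉ F →
      Disjoint (β.net.cut K ∪ β.net.postSet F) (β.net.post y) := fun hK hF =>
    disjoint_union_left.2 ⟨(hocc.disjoint_post_cut hK).symm,
      disjoint_right.2 fun _ hc => hocc.not_mem_postSet hF hc⟩
  obtain ⟨δ, hδ, hδl⟩ := exists_bijOn_of_mapMarking_indicator_eq (β := β)
    (hβ.1.finite_post x) (hβ.1.finite_post e) (by
      rw [mapMarking_indicator_of_bijOn (hβ.1.post_bij x),
        mapMarking_indicator_of_bijOn (hβ.1.post_bij e), hxe])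
  obtain ⟨γ', hγ'₁, hγ'₂, hγ'⟩ := hγ.exists_union hδ (hdisj hxK hxF) (hdisj heK heF)
  obtain ⟨φ', hφ'₁, hφ'₂, hφ'⟩ := hφ.exists_union (g := fun _ => e)
    (bijOn_singleton.2 rfl : BijOn _ {x} {e}) (disjoint_singleton_right.2 hxF)
    (disjoint_singleton_right.2 heF)
  have hpost : ∀ {K F : Set E} {y : E}, β.net.cut K ∪ β.net.postSet (insert y F) =
      (β.net.cut K ∪ β.net.postSet F) ∪ β.net.post y := by
    intro K F y
    rw [PetriNet.postSet_insert, union_assoc, union_comm (β.net.post y)]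
  refine ⟨insert x F₁, hF₁.insert_event hocc hxK hX, γ', φ', ?_, ?_, ?_, ?_⟩
  · simpa only [union_singleton] using hφ'
  · rwa [hpost, hpost]
  · rw [hpost]
    rintro c (hc | hc)
    · rw [hγ'₁ hc, hl c hc]
    · rw [hγ'₂ hc, hδl c hc]
  · rintro f (rfl | hf)
    · rw [hφ'₂ rfl, (hγ'₁.mono (hX.trans hcut_sub)).image_eq, hγ'₂.image_eq, hXe.image_eq,
        hδ.image_eq]
      exact ⟨hxe.symm, rfl, rfl⟩
    · have hsub : β.net.post f ⊆ β.net.cut K₁ ∪ β.net.postSet F₁ :=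
        (subset_biUnion_of_mem (u := β.net.post) hf).trans subset_union_right
      rw [hφ'₁ hf, (hγ'₁.mono (hF₁.pre_subset hf)).image_eq, (hγ'₁.mono hsub).image_eq]
      exact hφe f hf

/-- Completeness: every reachable marking is represented by a configuration without cut-off
events. -/
theorem exists_configuration_without_cutoff [Finite P] (hβ : β.IsUnfolding S)
    (hS : ∀ t, S.net.pre t = ∅ → S.net.post t = ∅) {r : Set E → Set E → Prop}
    (hr : β.IsAdequate r) {M : P → ℕ} (hM : S.net.Reachable S.M₀ M) :
    ∃ K, β.net.IsFinConfiguration K ∧ β.mark K = M ∧ ∀ e ∈ K, ¬ β.IsCutoff r e := by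
  have hocc := hβ.1.occ
  obtain ⟨K₀, hK₀, hK₀M⟩ := hβ.exists_configuration hS hM
  obtain ⟨⟨K, hK⟩, hKM, hmin⟩ := hr.wf.has_min {K | β.mark K.1 = M} ⟨⟨K₀, hK₀⟩, hK₀M⟩
  change β.mark K = M at hKM
  replace hmin : ∀ L, β.net.IsFinConfiguration L → β.mark L = M → ¬ r L K := fun L hL hLM =>
    hmin ⟨L, hL⟩ hLM
  replace hK : β.net.IsFinConfiguration K := hK
  -- An event with empty preset has empty postset, so deleting it preserves the cut and yields a
  -- proper subconfiguration, against minimality.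
  have hne : ∀ e ∈ K, (β.net.pre e).Nonempty := by
    intro e he
    rw [nonempty_iff_ne_empty]
    intro hpre
    have hpost : β.net.post e = ∅ := by
      have h₁ : S.net.pre (β.hE e) = ∅ := by
        rw [← (hβ.1.pre_bij e).image_eq, hpre, image_empty]
      have h₂ := (hβ.1.post_bij e).image_eq
      rwa [hS _ h₁, image_eq_empty] at h₂
    have hL : β.net.IsConfiguration (K \ {e}) := by
      refine hK.1.subset_of_closed sdiff_subset fun f hf g hgf => ⟨hK.1.2 f hf.1 g hgf, ?_⟩
      rintro rfl
      obtain ⟨c, hc, -⟩ := TransGen.head'_iff.1 hgf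
      rcases c with c | c
      · exact (hpost ▸ hc : c ∈ (∅ : Set C)).elim
      · exact hc.elim
    have hins : insert e (K \ {e}) = K := by simp [he]
    have hcut := hocc.cut_insert hL (e := e) (by simp)
    rw [hpre, hpost, hins, sdiff_empty, union_empty] at hcut
    have hLfin : β.net.IsFinConfiguration (K \ {e}) := ⟨hL, hK.2.sdiff⟩
    refine hmin _ hLfin (by rw [← hKM, mark, mark, hcut]) (hr.refines _ _ hLfin hK ?_)
    exact sdiff_singleton_ssubset.2 he
  refine ⟨K, hK, hKM, ?_⟩
  rintro e he ⟨e', hmark, hlt⟩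
  have hsub : β.net.localConf e ⊆ K := by
    rintro f (hf | rfl)
    · exact hK.1.2 e he f hf
    · exact he
  have hunion : β.net.localConf e ∪ K \ β.net.localConf e = K := union_sdiff_cancel hsub
  have hF₂ : β.net.IsSuffix (β.net.localConf e) (K \ β.net.localConf e) :=
    ⟨disjoint_sdiff_right, by rwa [hunion]⟩
  have he₁ := hocc.isFinConfiguration_localConf e
  have he₂ := hocc.isFinConfiguration_localConf e'
  -- Adequacy picks a copy for which the order is preserved, provided some copy exists.
  obtain ⟨F₁, hF₁, hiso, hlt'⟩ := hr.preserved _ _ he₂ he₁ hmark.symm hlt _ hF₂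
    (hβ.exists_suffixIso he₂ he₁ hmark.symm hF₂ fun f hf => hne f hf.1)
  rw [hunion] at hlt'
  refine hmin _ hF₁.2 ?_ hlt'
  rw [hiso.mark_eq he₂.1 he₁.1 hF₁ hF₂, hunion, hKM]

end IsUnfolding

end LabelledNet

/-! ### The complete prefix. -/

namespace LabelledNet

open Relation Set

variable {P T C E : Type*} {β : LabelledNet P T C E} {S : NetSystem P T} {D : Set C × Set E}
  {r : Set E → Set E → Prop}

namespace IsCutoffPrefix

/-- The set `A` and the conditions produced only by `A` form an admissible backward closed subnet,
so the greatest one contains it. -/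
theorem subnet_le (hD : β.IsCutoffPrefix r D) {A : Set E}
    (hA : A = {e | ∀ f, β.IsCutoff r f → ¬ β.net.Causal (Sum.inr f) (Sum.inr e)}) :
    {c | ∀ e, β.net.arcTP e c → e ∈ A} ⊆ D.1 ∧ A ⊆ D.2 := by
  have : ({c | ∀ e, β.net.arcTP e c → e ∈ A}, A) ≤ D := by
    refine hD.2 ⟨⟨fun c hc => hc, fun e he c hc g hg => ?_⟩, fun e he => ?_⟩ <;> subst hA
    · exact fun f hf hfg => he f hf
        (hfg.trans (PetriNet.causal_of_mem_post_of_mem_pre hg hc))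
    · exact he
  exact this

theorem mem_events (hD : β.IsCutoffPrefix r D) {e : E}
    (he : ∀ f, β.net.Causal (Sum.inr f) (Sum.inr e) → ¬ β.IsCutoff r f) : e ∈ D.2 :=
  (hD.subnet_le rfl).2 fun f hf hfe => he f hfe hf

theorem mem_conditions (hD : β.IsCutoffPrefix r D) {c : C}
    (hc : ∀ e, β.net.arcTP e c → e ∈ D.2) : c ∈ D.1 :=
  (hD.subnet_le rfl).1 fun e he => hD.1.2 e (hc e he)

theorem pre_subset (hD : β.IsCutoffPrefix r D) {e : E} (he : e ∈ D.2) : β.net.pre e ⊆ D.1 :=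
  fun c hc => hD.1.1.2 e he c hc

theorem post_subset (hD : β.IsCutoffPrefix r D) (hβ : β.net.IsOccurrenceNet) {e : E}
    (he : e ∈ D.2) : β.net.post e ⊆ D.1 :=
  fun c hc => hD.mem_conditions fun f hf => hβ.pre_condition c e f hc hf ▸ he

theorem minConditions_subset (hD : β.IsCutoffPrefix r D) : β.net.minConditions ⊆ D.1 :=
  fun _ hc => hD.mem_conditions fun e he => (hc e he).elim

theorem cut_subset (hD : β.IsCutoffPrefix r D) (hβ : β.net.IsOccurrenceNet) {K : Set E}
    (hK : K ⊆ D.2) : β.net.cut K ⊆ D.1 :=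
  sdiff_subset.trans (union_subset hD.minConditions_subset
    (iUnion₂_subset fun _ he => hD.post_subset hβ (hK he)))

end IsCutoffPrefix

theorem bijOn_hC_restrict {A : Set C} {Q : Set P} (hA : A ⊆ D.1) :
    BijOn (β.restrict D).hC (Subtype.val ⁻¹' A) Q ↔ BijOn β.hC A Q := by
  have : Subtype.val '' (Subtype.val ⁻¹' A : Set D.1) = A := by
    rw [image_preimage_eq_iff]
    simpa using hA
  conv_rhs => rw [← this]
  exact bijOn_comp_iff Subtype.val_injective.injOn

theorem mapMarking_restrict_indicator {A : Set C} (hA : A ⊆ D.1) :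
    (β.restrict D).mapMarking (A.indicator 1 ∘ Subtype.val) = β.mapMarking (A.indicator 1) := by
  have h : A.indicator (1 : C → ℕ) ∘ (Subtype.val : D.1 → C) =
      (Subtype.val ⁻¹' A : Set D.1).indicator 1 := rfl
  funext p
  rw [h, mapMarking_indicator, mapMarking_indicator,
    ← ncard_image_of_injective _ Subtype.val_injective]
  congr 1
  ext c
  constructor
  · rintro ⟨d, hd, rfl⟩
    exact hd
  · exact fun hc => ⟨⟨c, hA hc.1⟩, hc, rfl⟩

theorem minConditions_restrict (hD : β.BackwardClosed D) :
    (β.restrict D).net.minConditions = Subtype.val ⁻¹' β.net.minConditions := by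
  ext c
  exact ⟨fun hc e he => hc ⟨e, hD.1 c c.2 e he⟩ he, fun hc e he => hc e he⟩

theorem fires_restrict {M M' : C → ℕ} {e : D.2} (h : β.net.Fires M e M') :
    (β.restrict D).net.Fires (M ∘ Subtype.val) e (M' ∘ Subtype.val) :=
  ⟨fun c hc => h.1 c hc, fun c => h.2 c⟩

theorem reachableMarking_restrict_cut (hβ : β.net.IsOccurrenceNet) (hD : β.BackwardClosed D)
    {K : Set E} (hK : β.net.IsFinConfiguration K) (hKD : K ⊆ D.2) :
    (β.restrict D).ReachableMarking ((β.net.cut K).indicator 1 ∘ Subtype.val) := by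
  revert hKD
  refine hK.induction (motive := fun K => K ⊆ D.2 → (β.restrict D).ReachableMarking
    ((β.net.cut K).indicator 1 ∘ Subtype.val)) hβ (fun _ => ?_) ?_
  · rw [PetriNet.cut_empty]
    have : (β.restrict D).net.minMarking = β.net.minConditions.indicator 1 ∘ Subtype.val := by
      rw [PetriNet.minMarking, minConditions_restrict hD]
      rfl
    rw [← this]
    exact .refl
  · intro K e hK he hpre ih hKD
    exact (ih ((subset_insert e K).trans hKD)).tail
      ⟨⟨e, hKD (mem_insert e K)⟩, fires_restrict (hβ.fires_cut hK.1 he hpre)⟩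

theorem IsCutoffPrefix.exists_reachable_fires [Finite P] (hD : β.IsCutoffPrefix r D)
    (hβ : β.IsUnfolding S) (hS : ∀ t, S.net.pre t = ∅ → S.net.post t = ∅) (hr : β.IsAdequate r)
    {M : P → ℕ} (hM : S.net.Reachable S.M₀ M) {t : T} (ht : S.net.Enabled M t) :
    ∃ (e : D.2) (N N' : D.1 → ℕ), (β.restrict D).hE e = t ∧ (β.restrict D).ReachableMarking N ∧
      (β.restrict D).mapMarking N = M ∧ (β.restrict D).net.Fires N e N' := by
  have hocc := hβ.1.occ
  obtain ⟨K, hK, rfl, hKr⟩ := hβ.exists_configuration_without_cutoff hS hr hM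
  obtain ⟨e, rfl, he⟩ := hβ.exists_event_of_enabled hK.1 ht
  have hKD : K ⊆ D.2 := fun e he => hD.mem_events fun f hf => hKr f (hK.1.2 e he f hf)
  -- The event `e` may itself be a cut-off: only its strict predecessors matter, and they lie in
  -- `K`.
  have heD : e ∈ D.2 := by
    refine hD.mem_events fun f hf => hKr f ?_
    obtain ⟨c, hc, hfc⟩ := PetriNet.causal_inr_iff.1 hf
    exact hocc.mem_of_le_cut hK.1 (he hc) hfc
  have hen : β.net.Enabled ((β.net.cut K).indicator 1) e := fun c hc => by simp [he hc]
  obtain ⟨N', hN'⟩ := hen.exists_fires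
  exact ⟨⟨e, heD⟩, _, _, rfl, reachableMarking_restrict_cut hocc hD.1.1 hK hKD,
    mapMarking_restrict_indicator (hD.cut_subset hocc hKD), fires_restrict hN'⟩

end LabelledNet

/-! ### The equivalence of the two adjacency relations. -/

theorem proposition1 {P T C E : Type*} [Finite P] [Finite T] (S : NetSystem P T)
    (hS : ∀ t, S.net.pre t = ∅ → S.net.post t = ∅)
    (U : LabelledNet P T C E) (hU : U.IsUnfolding S)
    (r : Set E → Set E → Prop) (hr : U.IsAdequate r)
    (D : Set C × Set E) (hD : U.IsCutoffPrefix r D) (t₁ t₂ : T) :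
    S.TAR t₁ t₂ ↔
      ∃ e₁ e₂ : D.2, (U.restrict D).hE e₁ = t₁ ∧ (U.restrict D).hE e₂ = t₂ ∧
        (U.restrict D).EAR e₁ e₂ := by
  have hocc := hU.1.occ
  have hpre : ∀ e, Set.BijOn (U.restrict D).hC ((U.restrict D).net.pre e)
      (S.net.pre ((U.restrict D).hE e)) := fun e =>
    (LabelledNet.bijOn_hC_restrict (hD.pre_subset e.2)).2 (hU.1.pre_bij e)
  have hpost : ∀ e, Set.BijOn (U.restrict D).hC ((U.restrict D).net.post e)
      (S.net.post ((U.restrict D).hE e)) := fun e =>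
    (LabelledNet.bijOn_hC_restrict (hD.post_subset hocc e.2)).2 (hU.1.post_bij e)
  have hminC := LabelledNet.minConditions_restrict hD.1.1
  have hmin : (U.restrict D).mapMarking (U.restrict D).net.minMarking = S.M₀ := by
    rw [PetriNet.minMarking, hminC, ← hU.1.min_eq]
    exact LabelledNet.mapMarking_restrict_indicator hD.minConditions_subset
  have hfin : (U.restrict D).net.minConditions.Finite := by
    rw [hminC]
    exact hU.1.min_finite.preimage Subtype.val_injective.injOn
  have hreach : ∀ {M : D.1 → ℕ}, (U.restrict D).ReachableMarking M →
      M.support.Finite ∧ S.net.Reachable S.M₀ ((U.restrict D).mapMarking M) :=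
    LabelledNet.mapMarking_reachable hpre hpost hfin hmin
  constructor
  · rintro ⟨M, M', hM, hMM', ht₂⟩
    obtain ⟨e₁, N₁, N₁', rfl, hN₁, rfl, hf₁⟩ := hD.exists_reachable_fires hU hS hr hM hMM'.1
    obtain ⟨e₂, N₂, N₂', rfl, hN₂, rfl, hf₂⟩ :=
      hD.exists_reachable_fires hU hS hr (hM.tail ⟨_, hMM'⟩) ht₂
    refine ⟨e₁, e₂, rfl, rfl, N₁, N₁', N₂, N₂', hN₁, hN₁.tail ⟨_, hf₁⟩, hN₂, hN₂.tail ⟨_, hf₂⟩,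
      hf₁, hf₂, ?_⟩
    -- Both images result from firing the same transition at the same marking of `S`, and firing is
    -- deterministic.
    exact hMM'.unique (LabelledNet.mapMarking_fires (hpre e₁) (hpost e₁) (hreach hN₁).1 hf₁).2
  · rintro ⟨e₁, e₂, rfl, rfl, M₁, M₁', M₂, M₂', hM₁, -, hM₂, -, hf₁, hf₂, heq⟩
    have h₁ := LabelledNet.mapMarking_fires (hpre e₁) (hpost e₁) (hreach hM₁).1 hf₁
    have h₂ := LabelledNet.mapMarking_fires (hpre e₂) (hpost e₂) (hreach hM₂).1 hf₂
    exact ⟨_, _, (hreach hM₁).2, h₁.2, heq ▸ h₂.2.1⟩
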